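/- For integers $r,s\ge 0$ with $r+s>0$, let $\mathbb C^{r,s}$ be $\mathbb C^{r+s}$ equipped with the Hermitian form $\langle z,w\rangle_{r,s}=z_1\bar w_1+\cdots+z_r\bar w_r-z_{r+1}\bar w_{r+1}-\cdots-z_{r+s}\bar w_{r+s}$, and let $\mathbb P^{r,s}$ be its projectivization, of dimension $r+s-1$. Points $[z],[w]\in\mathbb P^{r,s}$ are orthogonal, $[z]\perp[w]$, if $\langle z,w\rangle_{r,s}=0$, and $[z]$ is a null point if $\langle z,z\rangle_{r,s}=0$. A local orthogonal map from $\mathbb P^{r,s}$ to $\mathbb P^{r',s'}$ is a holomorphic map $f:U\to\mathbb P^{r',s'}$, defined on a connected open set $U\subset\mathbb P^{r,s}$ containing a null point, such that $f(p)\perp f(q)$ for all $p,q\in U$ with $p\perp q$. Theorem. Let $f:U\to\mathbb P^{r',s'}$ be a local orthogonal map from $\mathbb P^{r,s}$ to $\mathbb P^{r',s'}$, and let $n:=\dim\mathbb P^{r,s}$, $n':=\dim\mathbb P^{r',s'}$. If there exists an integer $a\ge 0$ such that $$(a+1)(n+1)\le n'\le (a+2)n-(a^2+2a+2),$$ then the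 image $f(U)$ lies in a hyperplane of $\mathbb P^{r',s'}$. -/

import Mathlib

open scoped ComplexConjugate

/-- The space `ℂ^{r,s}`: the first `r` coordinates carry the sign `+`, the last `s` the sign `-`. -/
abbrev CSpace (r s : ℕ) : Type := Fin r ⊕ Fin s → ℂ

/-- The standard Hermitian form
`⟨z, w⟩_{r,s} = z₁ w̄₁ + ⋯ + z_r w̄_r - z_{r+1} w̄_{r+1} - ⋯ - z_{r+s} w̄_{r+s}`. -/
noncomputable def hermForm {r s : ℕ} (z w : CSpace r s) : ℂ :=
  (∑ i : Fin r, z (Sum.inl i) * conj (w (Sum.inl i))) -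
    ∑ j : Fin s, z (Sum.inr j) * conj (w (Sum.inr j))

/-- The projective space `ℙ^{r,s}` of complex lines in `ℂ^{r,s}`. -/
abbrev PSpace (r s : ℕ) : Type := Projectivization ℂ (CSpace r s)

/-- The topology of `ℙ^{r,s}`: the quotient topology from the nonzero vectors of `ℂ^{r,s}`. -/
noncomputable instance PSpace.instTopologicalSpace (r s : ℕ) : TopologicalSpace (PSpace r s) :=
  TopologicalSpace.coinduced
    (Projectivization.mk' ℂ : {v : CSpace r s // v ≠ 0} → PSpace r s) inferInstance

/-- Orthogonality of points of `ℙ^{r,s}`. -/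
def PSpace.Orth {r s : ℕ} (p q : PSpace r s) : Prop := hermForm p.rep q.rep = 0

/-- Null points of `ℙ^{r,s}`, i.e. points of the boundary of the generalized ball. -/
def PSpace.IsNull {r s : ℕ} (p : PSpace r s) : Prop := hermForm p.rep p.rep = 0

theorem hermForm_smul_smul {r s : ℕ} (a b : ℂ) (z w : CSpace r s) :
    hermForm (a • z) (b • w) = a * conj b * hermForm z w := by
  simp only [hermForm, Pi.smul_apply, smul_eq_mul, map_mul, mul_sub, Finset.mul_sum]
  congr 1 <;> refine Finset.sum_congr rfl fun i _ => by ring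

/-- Orthogonality may be tested on arbitrary representatives. -/
theorem PSpace.orth_mk_iff {r s : ℕ} (v w : CSpace r s) (hv : v ≠ 0) (hw : w ≠ 0) :
    PSpace.Orth (Projectivization.mk ℂ v hv) (Projectivization.mk ℂ w hw) ↔
      hermForm v w = 0 := by
  obtain ⟨a, ha⟩ := Projectivization.exists_smul_eq_mk_rep ℂ v hv
  obtain ⟨b, hb⟩ := Projectivization.exists_smul_eq_mk_rep ℂ w hw
  rw [PSpace.Orth, ← ha, ← hb, Units.smul_def, Units.smul_def, hermForm_smul_smul]
  simp

/-- `f` is holomorphic on `U`: near every nonzero vector `v` representing a point of `U`, it is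
given in homogeneous coordinates, `f [w] = [F w]`, by a nowhere vanishing holomorphic
vector-valued function `F` of `w`. The values of `f` outside `U` play no role. -/
def PSpace.HolomorphicOn {r s r' s' : ℕ} (f : PSpace r s → PSpace r' s')
    (U : Set (PSpace r s)) : Prop :=
  ∀ (v : CSpace r s) (hv : v ≠ 0), Projectivization.mk ℂ v hv ∈ U →
    ∃ (O : Set (CSpace r s)) (F : CSpace r s → CSpace r' s'),
      IsOpen O ∧ v ∈ O ∧ DifferentiableOn ℂ F O ∧
      ∀ (w : CSpace r s) (hw : w ≠ 0), w ∈ O → Projectivization.mk ℂ w hw ∈ U →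
        ∃ hF : F w ≠ 0, f (Projectivization.mk ℂ w hw) = Projectivization.mk ℂ (F w) hF

/-- `f` is a local orthogonal map from `ℙ^{r,s}` to `ℙ^{r',s'}` with domain of definition `U`. -/
structure IsLocalOrthogonalMap {r s r' s' : ℕ} (U : Set (PSpace r s))
    (f : PSpace r s → PSpace r' s') : Prop where
  isOpen : IsOpen U
  isConnected : IsConnected U
  exists_null : ∃ p ∈ U, PSpace.IsNull p
  holomorphic : PSpace.HolomorphicOn f U
  orthogonal : ∀ p ∈ U, ∀ q ∈ U, PSpace.Orth p q → PSpace.Orth (f p) (f q)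

/-- `S` lies in a hyperplane of `ℙ^{r,s}`, i.e. in the projectivization of a linear subspace of
`ℂ^{r,s}` of codimension one. -/
def PSpace.LiesInHyperplane {r s : ℕ} (S : Set (PSpace r s)) : Prop :=
  ∃ W : Submodule ℂ (CSpace r s),
    Module.finrank ℂ W + 1 = Module.finrank ℂ (CSpace r s) ∧ ∀ p ∈ S, p.submodule ≤ W

/-! Near a null point, lift `f` to a holomorphic `F` on a convex open set of vectors. Let `w i` be
the largest dimension of the span of `F` on the part of that set lying in the span of `i` of its
points (`genericRank`). If the image of the lift spans the target, then `w (n+1)` is at least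
`n'+1`, and two constraints on `w` collide.

Duality (`genericRank_add_genericRank_le`): `w k + w k' ≤ n'+1` when `k + k' = n+1`, since `F` sends
orthogonal subspaces to orthogonal spans. The null point provides complementary orthogonal subspaces
that both meet the domain.

Hyperplane restriction (`genericRank_add_min_le`): each increment of `w` is at least the next one,
up to a cap. So a single increment of `a+2` or more forces large increments before it, hence a large
value of `w` there; where increments are at most `a+1`, `w` descends slowly from `w (n+1)`. Either
way `w` stays above two lines of slope `a+1`, and for `k = (a+1)(a+2)/2 + 1` these give `w k + w k'
> n'+1` (`lt_add_of_growth`).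

Hence the lift takes values in a hyperplane, and the identity theorem carries this to all of `U`. -/

open Module Filter Topology

/-! ### Generic rank: semicontinuity and density -/

section GenericRank

variable {E T : Type*} [NormedAddCommGroup E] [NormedSpace ℂ E]
  [NormedAddCommGroup T] [NormedSpace ℂ T]

/-- The span of the values of `F` on the part of `O` in the subspace `L`. -/
def imageSpan (F : E → T) (O : Set E) (L : Submodule ℂ E) : Submodule ℂ T :=
  Submodule.span ℂ (F '' (O ∩ L))

theorem imageSpan_mono (F : E → T) (O : Set E) {L M : Submodule ℂ E} (h : L ≤ M) :
    imageSpan F O L ≤ imageSpan F O M :=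
  Submodule.span_mono (Set.image_mono (Set.inter_subset_inter_right _ h))

theorem linearIndependent_mkQ_bot {c : ℕ} {y : Fin c → T} :
    (LinearIndependent ℂ fun a => (⊥ : Submodule ℂ T).mkQ (y a)) ↔ LinearIndependent ℂ y :=
  LinearMap.linearIndependent_iff (v := y) (⊥ : Submodule ℂ T).mkQ (Submodule.ker_mkQ _)

variable [FiniteDimensional ℂ T]

/-- Linear independence modulo a subspace of the values of a holomorphic map at a tuple of points
propagates along affine complex lines in the space of tuples. -/
theorem frequently_linearIndependent_mkQ {O : Set E} (hO : IsOpen O) (hconv : Convex ℝ O)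
    {F : E → T} (hF : DifferentiableOn ℂ F O) (S : Submodule ℂ T) {c : ℕ} (A B : Fin c → E)
    (h0 : ∀ a, A a ∈ O) (h1 : ∀ a, A a + B a ∈ O)
    (hli : LinearIndependent ℂ fun a => S.mkQ (F (A a + B a))) :
    ∃ᶠ t in 𝓝 (0 : ℂ), LinearIndependent ℂ fun a => S.mkQ (F (A a + t • B a)) := by
  classical
  -- Functionals dual to the values at `t = 1`, so that the determinant `d` below equals 1 there.
  -- Its vanishing near 0 would propagate to 1 by the identity theorem.
  obtain ⟨g, hg⟩ : ∃ g : T ⧸ S →ₗ[ℂ] (Fin c → ℂ),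
      ∀ a, g (S.mkQ (F (A a + B a))) = Pi.single a 1 := by
    obtain ⟨g, hg⟩ := LinearMap.exists_leftInverse_of_injective
      (Fintype.linearCombination ℂ fun a => S.mkQ (F (A a + B a)))
      (LinearMap.ker_eq_bot.2
        (linearIndependent_iff_injective_fintypeLinearCombination.1 hli))
    refine ⟨g, fun a => ?_⟩
    have := LinearMap.congr_fun hg (Pi.single a 1)
    simpa [Fintype.linearCombination_apply_single] using this
  let φ : T →L[ℂ] (Fin c → ℂ) := LinearMap.toContinuousLinearMap (g ∘ₗ S.mkQ)
  let D : Set ℂ := {t | ∀ a, A a + t • B a ∈ O}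
  have hDo : IsOpen D := by
    have : D = ⋂ a, (fun t : ℂ => A a + t • B a) ⁻¹' O := by ext; simp [D]
    rw [this]
    exact isOpen_iInter_of_finite fun a => hO.preimage (by fun_prop)
  have hDc : Convex ℝ D := by
    intro s hs t ht α β hα hβ hαβ a
    have := hconv (hs a) (ht a) hα hβ hαβ
    have hA : A a = α • A a + β • A a := by rw [← add_smul, hαβ, one_smul]
    convert this using 1
    conv_lhs => rw [hA]
    simp only [smul_add, add_smul, smul_assoc]
    abel
  let d : ℂ → ℂ := fun t => (Matrix.of fun a b => φ (F (A a + t • B a)) b).det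
  have hd : DifferentiableOn ℂ d D := by
    have hent : ∀ a b, DifferentiableOn ℂ (fun t : ℂ => φ (F (A a + t • B a)) b) D := by
      intro a b
      have h2 : DifferentiableOn ℂ (fun t : ℂ => F (A a + t • B a)) D :=
        hF.comp (by fun_prop) fun t ht => ht a
      have h3 : DifferentiableOn ℂ (fun t : ℂ => φ (F (A a + t • B a))) D :=
        φ.differentiable.comp_differentiableOn h2
      exact differentiableOn_pi.1 h3 b
    have : d = fun t => ∑ σ : Equiv.Perm (Fin c),
        ((Equiv.Perm.sign σ : ℤ) : ℂ) * ∏ i, φ (F (A (σ i) + t • B (σ i))) i := by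
      ext t
      simp [d, Matrix.det_apply']
    rw [this]
    refine DifferentiableOn.fun_sum fun σ _ => DifferentiableOn.const_mul ?_ _
    exact DifferentiableOn.fun_finsetProd fun i _ => hent _ _
  have hd1 : d 1 = 1 := by
    have : (Matrix.of fun a b => φ (F (A a + (1 : ℂ) • B a)) b) = (1 : Matrix (Fin c) (Fin c) ℂ) := by
      ext a b
      have := congrFun (hg a) b
      simp only [Matrix.of_apply, one_smul, φ, LinearMap.coe_toContinuousLinearMap',
        LinearMap.comp_apply]
      rw [this, Matrix.one_apply, Pi.single_apply]
      simp [eq_comm]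
    simp only [d, this, Matrix.det_one]
  intro hev
  have hz : d =ᶠ[𝓝 0] 0 := by
    filter_upwards [hev] with t ht
    by_contra hne
    apply ht
    refine LinearIndependent.of_comp g ?_
    exact Matrix.linearIndependent_rows_of_det_ne_zero hne
  have := (hd.analyticOnNhd hDo).eqOn_zero_of_preconnected_of_eventuallyEq_zero
    hDc.isPreconnected (z₀ := 0) (by intro a; simpa using h0 a) hz
    (show (1 : ℂ) ∈ D by intro a; simpa using h1 a)
  rw [hd1] at this
  exact one_ne_zero this

/-- The rank of `F` on the span of a tuple of points. -/
noncomputable def tupleRank (F : E → T) (O : Set E) {i : ℕ} (x : Fin i → E) : ℕ :=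
  finrank ℂ (imageSpan F O (Submodule.span ℂ (Set.range x)))

/-- The largest rank of `F` on the span of an `i`-tuple of points of `O`. -/
noncomputable def genericRank (F : E → T) (O : Set E) (i : ℕ) : ℕ :=
  sSup {c | ∃ x : Fin i → E, (∀ a, x a ∈ O) ∧ tupleRank F O x = c}

theorem bddAbove_tupleRank (F : E → T) (O : Set E) (i : ℕ) :
    BddAbove {c | ∃ x : Fin i → E, (∀ a, x a ∈ O) ∧ tupleRank F O x = c} := by
  refine ⟨finrank ℂ T, ?_⟩
  rintro _ ⟨x, -, rfl⟩
  exact Submodule.finrank_le _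

theorem tupleRank_le_genericRank (F : E → T) {O : Set E} {i : ℕ} {x : Fin i → E}
    (hx : ∀ a, x a ∈ O) : tupleRank F O x ≤ genericRank F O i :=
  le_csSup (bddAbove_tupleRank F O i) ⟨x, hx, rfl⟩

theorem exists_tupleRank_eq_genericRank (F : E → T) {O : Set E} (hne : O.Nonempty) (i : ℕ) :
    ∃ x : Fin i → E, (∀ a, x a ∈ O) ∧ tupleRank F O x = genericRank F O i := by
  obtain ⟨p, hp⟩ := hne
  exact Nat.sSup_mem
    (s := {c | ∃ x : Fin i → E, (∀ a, x a ∈ O) ∧ tupleRank F O x = c})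
    ⟨_, fun _ => p, fun _ => hp, rfl⟩ (bddAbove_tupleRank F O i)

/-- Extraction of independent vectors, modulo a subspace, from a spanning set. -/
theorem exists_linearIndependent_mkQ_of_le (S : Submodule ℂ T) (Y : Set T) {c : ℕ}
    (hc : c ≤ finrank ℂ ((Submodule.span ℂ Y).map S.mkQ)) :
    ∃ y : Fin c → T, (∀ a, y a ∈ Y) ∧ LinearIndependent ℂ fun a => S.mkQ (y a) := by
  rw [Submodule.map_span] at hc
  obtain ⟨f, hf, -, hli⟩ := Submodule.exists_fun_fin_finrank_span_eq ℂ (S.mkQ '' Y)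
  choose g hgY hg using hf
  refine ⟨fun a => g (Fin.castLE hc a), fun a => hgY _, ?_⟩
  simp only [hg]
  exact hli.comp _ (Fin.castLE_injective hc)

theorem finrank_map_mkQ_add_finrank_inf (S M : Submodule ℂ T) :
    finrank ℂ (M.map S.mkQ) + finrank ℂ (S ⊓ M : Submodule ℂ T) = finrank ℂ M := by
  have h := LinearMap.finrank_range_add_finrank_ker (S.mkQ.domRestrict M)
  rw [LinearMap.range_domRestrict] at h
  rw [← h]
  congr 1
  have : LinearMap.ker (S.mkQ.domRestrict M) = S.comap M.subtype := by
    ext x; simp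
  rw [this, inf_comm, ← Submodule.map_comap_subtype]
  exact (Submodule.equivMapOfInjective M.subtype M.subtype_injective _).finrank_eq.symm

/-- With the coefficients `C` held fixed while `x` varies, the right-hand conditions are open in
`x`, and `C` can be transported to other tuples. -/
theorem le_tupleRank_iff (F : E → T) (O : Set E) {i c : ℕ} {x : Fin i → E} :
    c ≤ tupleRank F O x ↔ ∃ C : Fin c → Fin i → ℂ, (∀ a, ∑ b, C a b • x b ∈ O) ∧
      LinearIndependent ℂ fun a => F (∑ b, C a b • x b) := by
  constructor
  · intro h
    have h' : c ≤ finrank ℂ ((imageSpan F O (Submodule.span ℂ (Set.range x))).map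
        (⊥ : Submodule ℂ T).mkQ) := by
      have := finrank_map_mkQ_add_finrank_inf ⊥ (imageSpan F O (Submodule.span ℂ (Set.range x)))
      rw [bot_inf_eq, finrank_bot] at this
      rw [tupleRank] at h
      omega
    obtain ⟨y, hy, hli⟩ := exists_linearIndependent_mkQ_of_le _ _ h'
    rw [linearIndependent_mkQ_bot] at hli
    choose p hp hpy using hy
    have hex : ∀ a, ∃ C : Fin i → ℂ, ∑ b, C b • x b = p a := fun a =>
      (Submodule.mem_span_range_iff_exists_fun ℂ).1 (hp a).2
    choose C hC using hex
    refine ⟨C, fun a => by rw [hC]; exact (hp a).1, ?_⟩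
    simpa only [hC, hpy] using hli
  · rintro ⟨C, hC, hli⟩
    have hmem : ∀ a, F (∑ b, C a b • x b) ∈
        imageSpan F O (Submodule.span ℂ (Set.range x)) := fun a =>
      Submodule.subset_span ⟨_, ⟨hC a,
        (Submodule.mem_span_range_iff_exists_fun ℂ).2 ⟨C a, rfl⟩⟩, rfl⟩
    have := finrank_span_eq_card hli
    rw [Fintype.card_fin] at this
    rw [tupleRank, ← this]
    exact Submodule.finrank_mono (Submodule.span_le.2 (by rintro _ ⟨a, rfl⟩; exact hmem a))

/-- The rank on the span of a tuple is lower semicontinuous. -/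
theorem eventually_le_tupleRank {O : Set E} (hO : IsOpen O) {F : E → T} (hF : ContinuousOn F O)
    {i c : ℕ} {x : Fin i → E} (hx : c ≤ tupleRank F O x) :
    ∀ᶠ y in 𝓝 x, c ≤ tupleRank F O y := by
  obtain ⟨C, hC, hli⟩ := (le_tupleRank_iff F O).1 hx
  have hcont : ∀ a, Continuous fun y : Fin i → E => ∑ b, C a b • y b := fun a => by fun_prop
  have h1 : ∀ᶠ y in 𝓝 x, ∀ a, ∑ b, C a b • y b ∈ O :=
    eventually_all.2 fun a => (hcont a).continuousAt.eventually_mem (hO.mem_nhds (hC a))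
  have h2 : ContinuousAt (fun y : Fin i → E => fun a => F (∑ b, C a b • y b)) x :=
    continuousAt_pi.2 fun a =>
      ContinuousAt.comp (f := fun y : Fin i → E => ∑ b, C a b • y b)
        (hF.continuousAt (hO.mem_nhds (hC a))) (hcont a).continuousAt
  have h3 := h2.eventually hli.eventually
  filter_upwards [h1, h3] with y hy1 hy3
  exact (le_tupleRank_iff F O).2 ⟨C, hy1, hy3⟩

/-- Tuples at which the rank is generic are dense. -/
theorem frequently_genericRank_le {O : Set E} (hO : IsOpen O) (hconv : Convex ℝ O)
    {F : E → T} (hF : DifferentiableOn ℂ F O) {i : ℕ} {x₀ : Fin i → E} (hx₀ : ∀ a, x₀ a ∈ O) :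
    ∃ᶠ y in 𝓝 x₀, (∀ a, y a ∈ O) ∧ genericRank F O i ≤ tupleRank F O y := by
  cases i with
  | zero =>
    obtain ⟨x, -, hx⟩ : ∃ x : Fin 0 → E, (∀ a, x a ∈ O) ∧ tupleRank F O x = genericRank F O 0 :=
      Nat.sSup_mem (s := {c | ∃ x : Fin 0 → E, (∀ a, x a ∈ O) ∧ tupleRank F O x = c})
        ⟨_, x₀, hx₀, rfl⟩ (bddAbove_tupleRank F O 0)
    have : Tendsto (fun _ : ℕ => x₀) atTop (𝓝 x₀) := tendsto_const_nhds
    refine this.frequently (Frequently.of_forall fun _ => ⟨hx₀, ?_⟩)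
    rw [Subsingleton.elim x₀ x, hx]
  | succ i =>
    obtain ⟨x, hxO, hx⟩ := exists_tupleRank_eq_genericRank F ⟨x₀ 0, hx₀ 0⟩ (i + 1)
    generalize genericRank F O (i + 1) = c at hx ⊢
    obtain ⟨C, hC, hli⟩ := (le_tupleRank_iff F O).1 hx.ge
    -- The combinations `C` applied to `x₀` may leave `O`. Contracting them towards the first point
    -- of the tuple keeps them in its span, and a small `s` puts them in `O` for both `x` and `x₀`
    -- while preserving independence at `x`.
    have hf1 : ∃ᶠ s in 𝓝 (0 : ℂ), LinearIndependent ℂ fun a : Fin c =>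
        F (x 0 + s • (∑ b, C a b • x b - x 0)) := by
      have := frequently_linearIndependent_mkQ hO hconv hF ⊥ (fun _ : Fin c => x 0)
        (fun a => ∑ b, C a b • x b - x 0) (fun _ => hxO 0) (by simpa using hC)
        (by simpa only [linearIndependent_mkQ_bot, add_sub_cancel] using hli)
      simpa only [linearIndependent_mkQ_bot] using this
    have hev : ∀ z : Fin (i + 1) → E, z 0 ∈ O →
        ∀ᶠ s in 𝓝 (0 : ℂ), ∀ a : Fin c, z 0 + s • (∑ b, C a b • z b - z 0) ∈ O := by
      intro z hz
      refine eventually_all.2 fun a => ?_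
      have hcont : Continuous fun s : ℂ => z 0 + s • (∑ b, C a b • z b - z 0) := by fun_prop
      exact hcont.continuousAt.eventually_mem (hO.mem_nhds (by simpa using hz))
    obtain ⟨s, hs, hsx, hsx₀⟩ := (hf1.and_eventually ((hev x (hxO 0)).and (hev x₀ (hx₀ 0)))).exists
    let P : Fin c → (Fin (i + 1) → E) →ₗ[ℂ] E := fun a =>
      LinearMap.proj 0 + s • (∑ b, C a b • LinearMap.proj b - LinearMap.proj 0)
    have hP : ∀ a z, P a z = z 0 + s • (∑ b, C a b • z b - z 0) := by
      intro a z
      simp [P, LinearMap.sum_apply]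
    have hPspan : ∀ a z, ∃ K : Fin (i + 1) → ℂ, P a z = ∑ b, K b • z b := by
      intro a z
      have : P a z ∈ Submodule.span ℂ (Set.range z) := by
        rw [hP]
        have h0 : z 0 ∈ Submodule.span ℂ (Set.range z) := Submodule.subset_span ⟨0, rfl⟩
        refine add_mem h0 (Submodule.smul_mem _ _ (sub_mem (Submodule.sum_mem _ fun b _ => ?_) h0))
        exact Submodule.smul_mem _ _ (Submodule.subset_span ⟨b, rfl⟩)
      obtain ⟨K, hK⟩ := (Submodule.mem_span_range_iff_exists_fun ℂ).1 this
      exact ⟨K, hK.symm⟩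
    -- With `s` fixed the points `P a` depend linearly on the tuple, so independence at `x` spreads
    -- along the line from `x₀` to `x`.
    have hf2 : ∃ᶠ t in 𝓝 (0 : ℂ), LinearIndependent ℂ fun a : Fin c =>
        F (P a (x₀ + t • (x - x₀))) := by
      have := frequently_linearIndependent_mkQ hO hconv hF ⊥ (fun a : Fin c => P a x₀)
        (fun a => P a (x - x₀)) (fun a => by rw [hP]; exact hsx₀ a)
        (fun a => by rw [← map_add, add_sub_cancel, hP]; exact hsx a)
        (by
          rw [linearIndependent_mkQ_bot]
          simp only [← map_add, add_sub_cancel]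
          simpa only [hP] using hs)
      simpa only [linearIndependent_mkQ_bot, map_add, map_smul] using this
    have hcont : Continuous fun t : ℂ => x₀ + t • (x - x₀) := by fun_prop
    have h0 : Tendsto (fun t : ℂ => x₀ + t • (x - x₀)) (𝓝 0) (𝓝 x₀) := by
      simpa using hcont.tendsto 0
    have hPc : ∀ a, Continuous (P a) := fun a => by
      have : (P a : (Fin (i + 1) → E) → E) = fun z => z 0 + s • (∑ b, C a b • z b - z 0) :=
        funext (hP a)
      rw [this]; fun_prop
    have hev1 : ∀ᶠ t in 𝓝 (0 : ℂ), ∀ a, (x₀ + t • (x - x₀)) a ∈ O :=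
      eventually_all.2 fun a => (((continuous_apply a).tendsto _).comp h0).eventually_mem
        (hO.mem_nhds (hx₀ a))
    have hev2 : ∀ᶠ t in 𝓝 (0 : ℂ), ∀ a, P a (x₀ + t • (x - x₀)) ∈ O :=
      eventually_all.2 fun a => (((hPc a).tendsto _).comp h0).eventually_mem
        (hO.mem_nhds (by rw [hP]; exact hsx₀ a))
    refine h0.frequently ((hf2.and_eventually (hev1.and hev2)).mono ?_)
    rintro t ⟨ht, ht1, ht2⟩
    refine ⟨ht1, (le_tupleRank_iff F O).2 ?_⟩
    choose K hK using fun a => hPspan a (x₀ + t • (x - x₀))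
    refine ⟨K, fun a => by rw [← hK]; exact ht2 a, ?_⟩
    simpa only [hK] using ht

end GenericRank

/-! ### The generic hyperplane restriction theorem -/

section HyperplaneRestriction

variable {E T : Type*} [NormedAddCommGroup E] [NormedSpace ℂ E]
  [NormedAddCommGroup T] [NormedSpace ℂ T] [FiniteDimensional ℂ T]

theorem mem_span_of_mem_span_insert {H : Submodule ℂ E} {y v : E} {l : E →ₗ[ℂ] ℂ}
    (hl : H ≤ LinearMap.ker l) (hy : l y ≠ 0) (hv : v ∈ H ⊔ Submodule.span ℂ {y})
    (hlv : l v = 0) : v ∈ H := by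
  obtain ⟨u, hu, w, hw, rfl⟩ := Submodule.mem_sup.1 hv
  obtain ⟨c, rfl⟩ := Submodule.mem_span_singleton.1 hw
  have h1 : l u = 0 := hl hu
  rw [map_add, h1, zero_add, map_smul, smul_eq_mul] at hlv
  have : c = 0 := (mul_eq_zero.1 hlv).resolve_right hy
  simpa [this] using hu

/-- The generic hyperplane restriction theorem: the drop of the generic rank from dimension `j + 1`
to dimension `j` is at least the drop from dimension `j + 2` to `j + 1`, up to the cap `j + 1`. -/
theorem genericRank_add_min_le {O : Set E} (hO : IsOpen O) (hconv : Convex ℝ O)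
    (hne : O.Nonempty) {F : E → T} (hF : DifferentiableOn ℂ F O) (j : ℕ) :
    genericRank F O j + min (genericRank F O (j + 2) - genericRank F O (j + 1)) (j + 1) ≤
      genericRank F O (j + 1) := by
  obtain ⟨z, hzO, hz⟩ := exists_tupleRank_eq_genericRank F hne (j + 2)
  set y : E := z (Fin.last j).castSucc with hy
  set y' : E := z (Fin.last (j + 1)) with hy'
  -- Density makes the first `j` points of `z` generic as a `j`-tuple; semicontinuity preserves the
  -- rank of the whole tuple.
  obtain ⟨x, ⟨hxO, hx⟩, hM⟩ : ∃ x : Fin j → E, ((∀ a, x a ∈ O) ∧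
      genericRank F O j ≤ tupleRank F O x) ∧ genericRank F O (j + 2) ≤
        tupleRank F O (Fin.snoc (α := fun _ => E) (Fin.snoc (α := fun _ => E) x y) y') := by
    have hcont : Continuous fun x : Fin j → E =>
        (Fin.snoc (α := fun _ => E) (Fin.snoc (α := fun _ => E) x y) y') :=
      Continuous.finSnoc (A := fun _ => E)
        (Continuous.finSnoc (A := fun _ => E) continuous_id continuous_const) continuous_const
    have hz0 : Fin.snoc (α := fun _ => E)
        (Fin.snoc (α := fun _ => E) (fun i : Fin j => z i.castSucc.castSucc) y) y' = z := by
      ext i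
      refine Fin.lastCases ?_ (fun i => ?_) i
      · simp [hy']
      · refine Fin.lastCases ?_ (fun i => ?_) i
        · simp [hy]
        · simp
    have hev : ∀ᶠ v in 𝓝 z, genericRank F O (j + 2) ≤ tupleRank F O v :=
      eventually_le_tupleRank hO hF.continuousOn hz.ge
    rw [← hz0] at hev
    exact ((frequently_genericRank_le hO hconv hF (x₀ := fun i : Fin j => z i.castSucc.castSucc)
      fun a => hzO _).and_eventually (hcont.continuousAt.eventually hev)).exists
  have hyO : y ∈ O := hzO _
  have hy'O : y' ∈ O := hzO _
  clear_value y y'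
  clear hz hzO
  set H : Submodule ℂ E := Submodule.span ℂ (Set.range (Fin.snoc (α := fun _ => E) x y)) with hH
  set M : Submodule ℂ E := Submodule.span ℂ (Set.range
    (Fin.snoc (α := fun _ => E) (Fin.snoc (α := fun _ => E) x y) y')) with hMdef
  have hMH : M = H ⊔ Submodule.span ℂ {y'} := by
    rw [hMdef, Fin.range_snoc, Set.insert_eq, Submodule.span_union, sup_comm]
  have hxH : Submodule.span ℂ (Set.range x) ≤ H := by
    rw [hH, Fin.range_snoc]
    exact Submodule.span_mono (Set.subset_insert _ _)
  have hHr : finrank ℂ (imageSpan F O H) ≤ genericRank F O (j + 1) :=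
    tupleRank_le_genericRank F (x := Fin.snoc (α := fun _ => E) x y) fun a => by
      refine Fin.lastCases ?_ (fun i => ?_) a
      · simpa using hyO
      · simpa using hxO i
  have hM' : genericRank F O (j + 2) ≤ finrank ℂ (imageSpan F O M) := hM
  have hxr : genericRank F O j ≤ genericRank F O (j + 1) :=
    hx.trans ((Submodule.finrank_mono (imageSpan_mono F O hxH)).trans hHr)
  by_cases hy'H : y' ∈ H
  · have : M = H := by
      rw [hMH, sup_eq_left, Submodule.span_singleton_le_iff_mem]
      exact hy'H
    rw [this] at hM'
    have : genericRank F O (j + 2) - genericRank F O (j + 1) = 0 := by omega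
    rw [this]
    simpa using hxr
  obtain ⟨l, hly', hlH⟩ := Submodule.exists_le_ker_of_notMem hy'H
  set c := min (genericRank F O (j + 2) - genericRank F O (j + 1)) (j + 1) with hc
  have hcj : c ≤ j + 1 := min_le_right _ _
  set S := imageSpan F O H with hS
  obtain ⟨Y, hYM, hYli⟩ : ∃ Y : Fin c → E, (∀ a, Y a ∈ O ∩ M) ∧
      LinearIndependent ℂ fun a => S.mkQ (F (Y a)) := by
    obtain ⟨v, hv, hli⟩ := exists_linearIndependent_mkQ_of_le S (F '' (O ∩ M)) (c := c) (by
      have h1 := finrank_map_mkQ_add_finrank_inf S (imageSpan F O M)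
      have h2 : finrank ℂ (S ⊓ imageSpan F O M : Submodule ℂ T) ≤ finrank ℂ S :=
        Submodule.finrank_mono inf_le_left
      have h3 : c ≤ genericRank F O (j + 2) - genericRank F O (j + 1) := min_le_left _ _
      change c ≤ finrank ℂ ((imageSpan F O M).map S.mkQ)
      omega)
    choose Y hY hYv using hv
    exact ⟨Y, hY, by simpa only [hYv] using hli⟩
  set h₀ : Fin (j + 1) → E := Fin.snoc (α := fun _ => E) x y' with hh₀
  have hh₀O : ∀ b, h₀ b ∈ O := fun b => by
    refine Fin.lastCases ?_ (fun i => ?_) b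
    · simpa [hh₀] using hy'O
    · simpa [hh₀] using hxO i
  have hh₀M : ∀ b, h₀ b ∈ M := fun b => by
    rw [hMH]
    refine Fin.lastCases ?_ (fun i => ?_) b
    · simpa [hh₀] using Submodule.mem_sup_right (Submodule.mem_span_singleton_self y')
    · simpa [hh₀] using Submodule.mem_sup_left (hxH (Submodule.subset_span ⟨i, rfl⟩))
  -- The tuple `(x, y')` slides so that its first `c` points reach `Y` at `t = 1`; for some small
  -- `t` their values are already independent modulo `S`. Only `j + 1` points are available, hence
  -- the cap on `c`.
  let D : Fin (j + 1) → E := fun b => if hb : (b : ℕ) < c then Y ⟨b, hb⟩ - h₀ b else 0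
  have hDM : ∀ b, D b ∈ M := fun b => by
    simp only [D]
    split_ifs with hb
    · exact sub_mem (hYM _).2 (hh₀M b)
    · exact zero_mem _
  have hDc : ∀ a : Fin c, h₀ (Fin.castLE hcj a) + D (Fin.castLE hcj a) = Y a := fun a => by
    simp [D]
  let h : ℂ → Fin (j + 1) → E := fun t => h₀ + t • D
  have hcont : Continuous h := by fun_prop
  have hh0 : h 0 = h₀ := by simp [h]
  have hfreq : ∃ᶠ t in 𝓝 (0 : ℂ), LinearIndependent ℂ fun a : Fin c =>
      S.mkQ (F (h t (Fin.castLE hcj a))) :=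
    frequently_linearIndependent_mkQ hO hconv hF S (fun a => h₀ (Fin.castLE hcj a))
      (fun a => D (Fin.castLE hcj a)) (fun a => hh₀O _) (fun a => by rw [hDc]; exact (hYM a).1)
      (by simpa only [hDc] using hYli)
  have hev1 : ∀ᶠ t in 𝓝 (0 : ℂ), ∀ b, h t b ∈ O := eventually_all.2 fun b =>
    ((continuous_apply b).comp hcont).continuousAt.eventually_mem
      (hO.mem_nhds (by simpa [hh0] using hh₀O b))
  have hlt : ∀ b, Continuous fun t => l (h t b) := fun b => by
    have : (fun t => l (h t b)) = fun t => l (h₀ b) + t * l (D b) := by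
      ext t; simp [h]
    rw [this]; fun_prop
  have hl0 : l (h 0 (Fin.last j)) ≠ 0 := by simpa [hh0, hh₀] using hly'
  have hev2 : ∀ᶠ t in 𝓝 (0 : ℂ), l (h t (Fin.last j)) ≠ 0 :=
    (hlt _).continuousAt.eventually_ne hl0
  -- Projecting to `ker l` along the last point gives a `j`-tuple in `H ⊓ H'` that equals `x` at `t
  -- = 0`, so its rank is still generic for small `t`.
  let X : ℂ → Fin j → E := fun t i =>
    h t i.castSucc - (l (h t i.castSucc) / l (h t (Fin.last j))) • h t (Fin.last j)
  have hX0 : X 0 = x := by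
    ext i
    have : l (x i) = 0 := hlH (hxH (Submodule.subset_span ⟨i, rfl⟩))
    simp [X, hh0, hh₀, this]
  have hXc : ContinuousAt X 0 := continuousAt_pi.2 fun i => by
    have hb : ∀ b, ContinuousAt (fun t => h t b) 0 := fun b =>
      ((continuous_apply b).comp hcont).continuousAt
    exact (hb _).sub ((((hlt _).continuousAt).div (hlt _).continuousAt hl0).smul (hb _))
  have hev3 : ∀ᶠ t in 𝓝 (0 : ℂ), genericRank F O j ≤ tupleRank F O (X t) := by
    have := eventually_le_tupleRank hO hF.continuousOn hx
    rw [← hX0] at this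
    exact hXc.eventually this
  obtain ⟨t, htli, htO, htl, htX⟩ := (hfreq.and_eventually (hev1.and (hev2.and hev3))).exists
  have hhM : ∀ b, h t b ∈ M := fun b => add_mem (hh₀M b) (Submodule.smul_mem _ _ (hDM b))
  set H' : Submodule ℂ E := Submodule.span ℂ (Set.range (h t)) with hH'
  have hhH' : ∀ b, h t b ∈ H' := fun b => Submodule.subset_span ⟨b, rfl⟩
  have hXH' : Submodule.span ℂ (Set.range (X t)) ≤ H' := by
    rw [Submodule.span_le]
    rintro _ ⟨i, rfl⟩
    exact sub_mem (hhH' _) (Submodule.smul_mem _ _ (hhH' _))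
  have hXH : Submodule.span ℂ (Set.range (X t)) ≤ H := by
    rw [Submodule.span_le]
    rintro _ ⟨i, rfl⟩
    refine mem_span_of_mem_span_insert hlH hly' ?_ ?_
    · rw [← hMH]
      exact sub_mem (hhM _) (Submodule.smul_mem _ _ (hhM _))
    · simp [X, div_mul_cancel₀ _ htl]
  have hr1 : genericRank F O j ≤ finrank ℂ (S ⊓ imageSpan F O H' : Submodule ℂ T) :=
    htX.trans (Submodule.finrank_mono
      (le_inf (imageSpan_mono F O hXH) (imageSpan_mono F O hXH')))
  have hr2 : finrank ℂ (imageSpan F O H') ≤ genericRank F O (j + 1) :=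
    tupleRank_le_genericRank F htO
  have hr3 : c ≤ finrank ℂ ((imageSpan F O H').map S.mkQ) := by
    have := finrank_span_eq_card htli
    rw [Fintype.card_fin] at this
    rw [← this]
    refine Submodule.finrank_mono (Submodule.span_le.2 ?_)
    rintro _ ⟨a, rfl⟩
    exact Submodule.mem_map_of_mem (Submodule.subset_span ⟨_, ⟨htO _, hhH' _⟩, rfl⟩)
  -- The image span of `H'` has at least `c` dimensions modulo `S` and at least `genericRank F O j`
  -- inside `S`.
  have := finrank_map_mkQ_add_finrank_inf S (imageSpan F O H')
  omega

/-- For small `t ≠ 0` both `z` and `z + t • v` lie in `O ∩ L`, and their difference recovers `v`. -/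
theorem span_inter_eq_of_isOpen {O : Set E} (hO : IsOpen O) {L : Submodule ℂ E} {z : E}
    (hz : z ∈ O) (hzL : z ∈ L) : Submodule.span ℂ (O ∩ L) = L := by
  refine le_antisymm (Submodule.span_le.2 Set.inter_subset_right) fun v hv => ?_
  have hcont : Continuous fun t : ℂ => z + t • v := by fun_prop
  have hev : ∀ᶠ t in 𝓝 (0 : ℂ), z + t • v ∈ O :=
    hcont.continuousAt.eventually_mem (hO.mem_nhds (by simpa using hz))
  obtain ⟨t, ht, ht0⟩ := ((hev.filter_mono nhdsWithin_le_nhds).and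
    (self_mem_nhdsWithin : {0}ᶜ ∈ 𝓝[≠] (0 : ℂ))).exists
  have h1 : z + t • v ∈ Submodule.span ℂ (O ∩ L : Set E) :=
    Submodule.subset_span ⟨ht, add_mem hzL (L.smul_mem t hv)⟩
  have h2 : z ∈ Submodule.span ℂ (O ∩ L : Set E) := Submodule.subset_span ⟨hz, hzL⟩
  have h3 := Submodule.smul_mem _ t⁻¹ (sub_mem h1 h2)
  rwa [add_sub_cancel_left, inv_smul_smul₀ ht0] at h3

theorem exists_basis_mem_of_isOpen [FiniteDimensional ℂ E] {O : Set E} (hO : IsOpen O)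
    {L : Submodule ℂ E} {z : E} (hz : z ∈ O) (hzL : z ∈ L) {k : ℕ} (hk : finrank ℂ L = k) :
    ∃ x : Fin k → E, (∀ a, x a ∈ O ∧ x a ∈ L) ∧ Submodule.span ℂ (Set.range x) = L ∧
      LinearIndependent ℂ x := by
  have h := Submodule.exists_fun_fin_finrank_span_eq ℂ (O ∩ L : Set E)
  rw [span_inter_eq_of_isOpen hO hz hzL, hk] at h
  exact h

theorem finrank_span_image_le_genericRank [FiniteDimensional ℂ E] (F : E → T) {O : Set E}
    (hO : IsOpen O) (hne : O.Nonempty) :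
    finrank ℂ (Submodule.span ℂ (F '' O)) ≤ genericRank F O (finrank ℂ E) := by
  obtain ⟨z, hz⟩ := hne
  obtain ⟨x, hx, hspan, -⟩ := exists_basis_mem_of_isOpen hO (L := ⊤) hz trivial (finrank_top ℂ E)
  have := tupleRank_le_genericRank F fun a => (hx a).1
  rwa [tupleRank, hspan, imageSpan, Submodule.top_coe, Set.inter_univ] at this

end HyperplaneRestriction

/-! ### Arithmetic of rank sequences -/

section Growth

variable {w : ℕ → ℕ}

/-- Going down from `j`, the cap at each level cuts `min m (l + 2)` to `min m (l + 1)`. -/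
theorem min_le_increment (hw : ∀ j, w j + min (w (j + 2) - w (j + 1)) (j + 1) ≤ w (j + 1))
    {m j : ℕ} (hm : w j + m ≤ w (j + 1)) {l : ℕ} (hl : l ≤ j) :
    w l + min m (l + 1) ≤ w (l + 1) := by
  induction hl using Nat.decreasingInduction with
  | self => omega
  | of_succ l hl ih =>
    have := hw l
    change w (l + 1) + _ ≤ w (l + 2) at ih
    omega

/-- Sum of the increments `1, 2, …, m, m, m, …`, doubled to avoid fractions. For `l ≤ m` the
triangular bound suffices, since `m - l ≤ (m - l)²`. -/
theorem growth_lower_bound (hw : ∀ j, w j + min (w (j + 2) - w (j + 1)) (j + 1) ≤ w (j + 1))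
    {m j : ℕ} (hm : w j + m ≤ w (j + 1)) {l : ℕ} (hl : l ≤ j) :
    2 * m * l + m ≤ 2 * w l + m * m := by
  have key : ∀ l, l ≤ j → (l ≤ m → l * (l + 1) ≤ 2 * w l) ∧ 2 * m * l + m ≤ 2 * w l + m * m := by
    intro l
    induction l with
    | zero =>
      intro _
      refine ⟨fun _ => by simp, ?_⟩
      nlinarith [Nat.zero_le (w 0), Nat.le_mul_self m]
    | succ l ih =>
      intro hl
      obtain ⟨h1, h2⟩ := ih (by omega)
      have h3 := min_le_increment hw hm (l := l) (by omega)
      have h4 : l + 1 ≤ m → (l + 1) * (l + 1 + 1) ≤ 2 * w (l + 1) := by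
        intro h
        have := h1 (by omega)
        have : min m (l + 1) = l + 1 := min_eq_right h
        nlinarith
      refine ⟨h4, ?_⟩
      rcases le_or_gt (l + 1) m with h | h
      · have h5 := h4 h
        obtain ⟨d, rfl⟩ := Nat.exists_eq_add_of_le h
        nlinarith [Nat.le_mul_self d]
      · have : min m (l + 1) = m := min_eq_left (by omega)
        nlinarith
  exact (key l hl).2

/-- The numerical contradiction behind the gap theorem. -/
theorem lt_add_of_growth (hw : ∀ j, w j + min (w (j + 2) - w (j + 1)) (j + 1) ≤ w (j + 1))
    {n N a k k' : ℕ} (hk : 2 * k = a * a + 3 * a + 4) (hkk' : k + k' = n + 1)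
    (hN : N ≤ w (n + 1)) (hN1 : (a + 1) * (n + 1) + 1 ≤ N)
    (hN2 : N + (a * a + 2 * a + 1) ≤ (a + 2) * n) : N < w k + w k' := by
  have hmono : ∀ j, w j ≤ w (j + 1) := fun j => le_trans (Nat.le_add_right _ _) (hw j)
  -- For `m = a + 2` the growth bound falls short of `m * j` by `m(m-1)/2 = k - 1`.
  have hbig : ∀ j, w (j + 1) ≤ w j + (a + 1) ∨ (a + 2) * j + 1 ≤ w j + k := by
    intro j
    rcases le_or_gt (w (j + 1)) (w j + (a + 1)) with h | h
    · exact Or.inl h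
    · have := growth_lower_bound hw (m := a + 2) (j := j) (by omega) le_rfl
      right
      nlinarith
  have h1 : ∀ i, i ≤ n + 1 → k ≤ i → (a + 1) * i + 1 ≤ w i := by
    intro i hi
    induction hi using Nat.decreasingInduction with
    | self => intro; omega
    | of_succ i hi ih =>
      intro hki
      have := ih (by omega)
      rcases hbig i with h | h <;> nlinarith
  -- In the large-increment case at `i = k'`, this is exactly the upper bound `hN2` on `N`.
  have h2 : ∀ i, i ≤ n + 1 → k' ≤ i → N + (a + 1) * i ≤ w i + (a + 1) * (n + 1) := by
    intro i hi
    induction hi using Nat.decreasingInduction with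
    | self => intro; omega
    | of_succ i hi ih =>
      intro hki
      have := ih (by omega)
      rcases hbig i with h | h <;> nlinarith
  have h3 := h1 k (by omega) le_rfl
  have h4 := h2 k' (by omega) le_rfl
  have : (a + 1) * (n + 1) = (a + 1) * k + (a + 1) * k' := by rw [← mul_add, hkk']
  omega

end Growth

/-! ### Orthogonality and duality of generic ranks -/

section Hermitian

variable {r s : ℕ}

/-- The linear map turning the Hermitian form into the standard inner product. -/
noncomputable def signedToEuclidean (r s : ℕ) :
    CSpace r s →ₗ[ℂ] EuclideanSpace ℂ (Fin r ⊕ Fin s) where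
  toFun w := WithLp.toLp 2 (Sum.elim (fun i => w (Sum.inl i)) fun j => -w (Sum.inr j))
  map_add' v w := by
    ext i; rcases i with i | i <;> simp [add_comm]
  map_smul' c w := by
    ext i; rcases i with i | i <;> simp

theorem signedToEuclidean_injective (r s : ℕ) : Function.Injective (signedToEuclidean r s) := by
  rw [← LinearMap.ker_eq_bot, LinearMap.ker_eq_bot']
  intro w hw
  ext i
  have h : ∀ i, (signedToEuclidean r s w) i = 0 := fun i => by rw [hw]; rfl
  rcases i with i | i
  · simpa [signedToEuclidean] using h (Sum.inl i)
  · simpa [signedToEuclidean] using h (Sum.inr i)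

theorem inner_signedToEuclidean (z w : CSpace r s) :
    inner ℂ (signedToEuclidean r s w) (WithLp.toLp 2 z) = hermForm z w := by
  simp [signedToEuclidean, hermForm, EuclideanSpace.inner_eq_star_dotProduct, dotProduct,
    sub_eq_add_neg]

theorem hermForm_conj (z w : CSpace r s) : hermForm w z = conj (hermForm z w) := by
  simp [hermForm, mul_comm]

theorem hermForm_eq_zero_comm {z w : CSpace r s} : hermForm z w = 0 ↔ hermForm w z = 0 := by
  rw [hermForm_conj z w]; simp

theorem hermForm_sub_left (z z' w : CSpace r s) :
    hermForm (z - z') w = hermForm z w - hermForm z' w := by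
  simp only [← inner_signedToEuclidean, WithLp.toLp_sub, inner_sub_right]

theorem hermForm_sum_smul_left {ι : Type*} (t : Finset ι) (c : ι → ℂ) (g : ι → CSpace r s)
    (w : CSpace r s) : hermForm (∑ i ∈ t, c i • g i) w = ∑ i ∈ t, c i * hermForm (g i) w := by
  simp only [← inner_signedToEuclidean, WithLp.toLp_sum, WithLp.toLp_smul, inner_sum,
    inner_smul_right]

theorem continuous_hermForm :
    Continuous fun p : CSpace r s × CSpace r s => hermForm p.1 p.2 := by
  unfold hermForm
  have := Complex.continuous_conj
  fun_prop

/-- The orthogonal complement for the Hermitian form. -/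
noncomputable def hermPerp (L : Submodule ℂ (CSpace r s)) : Submodule ℂ (CSpace r s) :=
  ((L.map (signedToEuclidean r s))ᗮ).map
    (WithLp.linearEquiv 2 ℂ (CSpace r s) : EuclideanSpace ℂ (Fin r ⊕ Fin s) →ₗ[ℂ] CSpace r s)

theorem mem_hermPerp {L : Submodule ℂ (CSpace r s)} {z : CSpace r s} :
    z ∈ hermPerp L ↔ ∀ w ∈ L, hermForm z w = 0 := by
  rw [hermPerp, Submodule.mem_map_equiv, Submodule.mem_orthogonal]
  simp only [Submodule.mem_map, forall_exists_index, and_imp, forall_apply_eq_imp_iff₂]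
  refine forall₂_congr fun w _ => ?_
  rw [← inner_signedToEuclidean]
  rfl

theorem finrank_add_finrank_hermPerp (L : Submodule ℂ (CSpace r s)) :
    finrank ℂ L + finrank ℂ (hermPerp L) = r + s := by
  have h1 := (L.map (signedToEuclidean r s)).finrank_add_finrank_orthogonal
  have h2 : finrank ℂ (hermPerp L) = finrank ℂ (L.map (signedToEuclidean r s))ᗮ :=
    LinearEquiv.finrank_map_eq (WithLp.linearEquiv 2 ℂ (CSpace r s)) _
  have h3 : finrank ℂ (L.map (signedToEuclidean r s)) = finrank ℂ L :=
    (Submodule.equivMapOfInjective _ (signedToEuclidean_injective r s) L).finrank_eq.symm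
  rw [h2, ← h3, h1]
  simp

theorem le_hermPerp_comm {L M : Submodule ℂ (CSpace r s)} : L ≤ hermPerp M ↔ M ≤ hermPerp L :=
  ⟨fun h w hw => mem_hermPerp.2 fun _ hz => hermForm_eq_zero_comm.1 (mem_hermPerp.1 (h hz) w hw),
    fun h w hw => mem_hermPerp.2 fun _ hz => hermForm_eq_zero_comm.1 (mem_hermPerp.1 (h hz) w hw)⟩

theorem span_le_hermPerp_span {X Y : Set (CSpace r s)}
    (h : ∀ x ∈ X, ∀ y ∈ Y, hermForm x y = 0) :
    Submodule.span ℂ X ≤ hermPerp (Submodule.span ℂ Y) := by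
  rw [le_hermPerp_comm, Submodule.span_le]
  intro y hy
  refine (le_hermPerp_comm.1 ?_) (Submodule.mem_span_singleton_self y)
  rw [Submodule.span_le]
  intro x hx
  refine mem_hermPerp.2 fun w hw => ?_
  obtain ⟨c, rfl⟩ := Submodule.mem_span_singleton.1 hw
  have := hermForm_smul_smul 1 c x y
  rw [one_smul] at this
  rw [this, h x hx y hy, mul_zero]

theorem finrank_add_le_of_le_hermPerp {L M : Submodule ℂ (CSpace r s)} (h : L ≤ hermPerp M) :
    finrank ℂ L + finrank ℂ M ≤ r + s := by
  have := finrank_add_finrank_hermPerp M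
  have := Submodule.finrank_mono h
  omega

/-- A tuple orthogonal to an independent tuple can be adjusted to remain orthogonal when the latter
is moved slightly. -/
theorem eventually_exists_orthogonal {k k' : ℕ} {x : Fin k → CSpace r s}
    {x' : Fin k' → CSpace r s} (hli : LinearIndependent ℂ x')
    (hort : ∀ i j, hermForm (x i) (x' j) = 0) {N : Set (Fin k → CSpace r s)} (hN : N ∈ 𝓝 x) :
    ∀ᶠ u in 𝓝 x', ∃ v ∈ N, ∀ i j, hermForm (v i) (u j) = 0 := by
  -- Sign-flipped copies of `x'`: their pairings with `x'` form a definite Gram matrix, so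
  -- corrections along `g` can be solved for near `x'` even though the form is indefinite.
  let g : Fin k' → CSpace r s := fun l => WithLp.ofLp (signedToEuclidean r s (x' l))
  let A : (Fin k' → CSpace r s) → Matrix (Fin k') (Fin k') ℂ :=
    fun u => Matrix.of fun l j => hermForm (g l) (u j)
  have hA : Continuous A := by
    refine continuous_matrix fun l j => ?_
    exact continuous_hermForm.comp (continuous_const.prodMk (continuous_apply j))
  have hA0 : (A x').det ≠ 0 := by
    have h1 : LinearIndependent ℂ fun l => signedToEuclidean r s (x' l) :=
      hli.map' _ (LinearMap.ker_eq_bot.2 (signedToEuclidean_injective r s))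
    have h2 := Matrix.det_gram_ne_zero_iff_linearIndependent.2 h1
    have h3 : A x' = (Matrix.gram ℂ fun l => signedToEuclidean r s (x' l)).transpose := by
      ext l j
      simp only [A, g, Matrix.of_apply, Matrix.transpose_apply, Matrix.gram_apply,
        ← inner_signedToEuclidean, WithLp.toLp_ofLp]
    rwa [h3, Matrix.det_transpose]
  let V : (Fin k' → CSpace r s) → Fin k → CSpace r s := fun u i =>
    x i - ∑ l, (Matrix.vecMul (fun j => hermForm (x i) (u j)) (A u)⁻¹) l • g l
  have hV0 : V x' = x := by
    ext1 i
    have : (fun j => hermForm (x i) (x' j)) = 0 := funext fun j => hort i j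
    simp [V, this]
  have hinv : ContinuousAt (fun u => (A u)⁻¹) x' := by
    simp only [Matrix.inv_def, Ring.inverse_eq_inv']
    exact (hA.matrix_det.continuousAt.inv₀ hA0).smul hA.matrix_adjugate.continuousAt
  have hVc : ContinuousAt V x' := by
    refine continuousAt_pi.2 fun i => continuousAt_const.sub ?_
    refine tendsto_finsetSum _ fun l _ => Tendsto.smul_const ?_ _
    simp only [Matrix.vecMul, dotProduct]
    refine tendsto_finsetSum _ fun j _ => Tendsto.mul ?_ ?_
    · have hc : Continuous fun u : Fin k' → CSpace r s => hermForm (x i) (u j) :=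
        continuous_hermForm.comp (continuous_const.prodMk (continuous_apply j))
      exact hc.tendsto _
    · have hc : Continuous fun m : Matrix (Fin k') (Fin k') ℂ => m j l := by fun_prop
      exact (hc.tendsto _).comp hinv
  have hev1 : ∀ᶠ u in 𝓝 x', V u ∈ N := hVc.eventually_mem (by rwa [hV0])
  have hev2 : ∀ᶠ u in 𝓝 x', (A u).det ≠ 0 := hA.matrix_det.continuousAt.eventually_ne hA0
  filter_upwards [hev1, hev2] with u h1 h2
  refine ⟨V u, h1, fun i j => ?_⟩
  have h3 : Matrix.vecMul (Matrix.vecMul (fun j => hermForm (x i) (u j)) (A u)⁻¹) (A u) j =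
      hermForm (x i) (u j) := by
    rw [Matrix.vecMul_vecMul, Matrix.nonsing_inv_mul _ (isUnit_iff_ne_zero.2 h2),
      Matrix.vecMul_one]
  simp only [V, hermForm_sub_left, hermForm_sum_smul_left]
  rw [sub_eq_zero, ← h3]
  rfl

theorem Submodule.exists_finrank_eq_of_mem {K V : Type*} [Field K] [AddCommGroup V] [Module K V]
    [FiniteDimensional K V] {Q : Submodule K V} {z : V} (hz : z ≠ 0) (hzQ : z ∈ Q) {k : ℕ}
    (hk : k + 1 ≤ finrank K Q) : ∃ L ≤ Q, z ∈ L ∧ finrank K L = k + 1 := by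
  induction k with
  | zero =>
    exact ⟨K ∙ z, (Submodule.span_singleton_le_iff_mem _ _).2 hzQ,
      Submodule.mem_span_singleton_self z, finrank_span_singleton hz⟩
  | succ k ih =>
    obtain ⟨L, hLQ, hzL, hL⟩ := ih (by omega)
    have hlt : L < Q := lt_of_le_of_ne hLQ fun h => by rw [h] at hL; omega
    obtain ⟨v, hvQ, hvL⟩ := SetLike.exists_of_lt hlt
    exact ⟨L ⊔ K ∙ v, sup_le hLQ ((Submodule.span_singleton_le_iff_mem _ _).2 hvQ),
      Submodule.mem_sup_left hzL, by rw [Submodule.finrank_sup_span_singleton hvL, hL]⟩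

variable {r' s' : ℕ}

/-- Generic ranks of an orthogonal map in complementary dimensions add up to at most the dimension
of the target. -/
theorem genericRank_add_genericRank_le {O : Set (CSpace r s)} (hO : IsOpen O)
    (hconv : Convex ℝ O) {z₀ : CSpace r s} (hz₀O : z₀ ∈ O) (hz₀ : z₀ ≠ 0)
    (hnull : hermForm z₀ z₀ = 0) {F : CSpace r s → CSpace r' s'} (hF : DifferentiableOn ℂ F O)
    (hort : ∀ z ∈ O, ∀ w ∈ O, hermForm z w = 0 → hermForm (F z) (F w) = 0)
    {k k' : ℕ} (hk : 1 ≤ k) (hk' : 1 ≤ k') (hkk' : k + k' = r + s) :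
    genericRank F O k + genericRank F O k' ≤ r' + s' := by
  -- As `z₀` is null, `L'` can contain `z₀` and lie in its complement; then `L'` and `hermPerp L'`
  -- both pass through `z₀`, hence meet `O`.
  obtain ⟨L', hL'perp, hzL', hL'⟩ :
      ∃ L' ≤ hermPerp (ℂ ∙ z₀), z₀ ∈ L' ∧ finrank ℂ L' = k' - 1 + 1 := by
    have h1 := finrank_add_finrank_hermPerp (ℂ ∙ z₀)
    rw [finrank_span_singleton hz₀] at h1
    refine Submodule.exists_finrank_eq_of_mem hz₀ ?_ (by omega)
    refine span_le_hermPerp_span (X := {z₀}) (Y := {z₀}) ?_ (Submodule.mem_span_singleton_self z₀)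
    rintro _ rfl _ rfl
    exact hnull
  have hzL : z₀ ∈ hermPerp L' :=
    (le_hermPerp_comm.1 hL'perp) (Submodule.mem_span_singleton_self z₀)
  have hL : finrank ℂ (hermPerp L') = k := by
    have := finrank_add_finrank_hermPerp L'
    omega
  obtain ⟨x₀, hx₀, -, hx₀li⟩ := exists_basis_mem_of_isOpen hO hz₀O hzL hL
  obtain ⟨x₀', hx₀', -, hx₀li'⟩ :=
    exists_basis_mem_of_isOpen hO hz₀O hzL' (hL'.trans (Nat.sub_add_cancel hk'))
  have hort₀ : ∀ j i, hermForm (x₀' j) (x₀ i) = 0 := fun j i =>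
    hermForm_eq_zero_comm.1 (mem_hermPerp.1 (hx₀ i).2 _ (hx₀' j).2)
  have hopen : ∀ {m : ℕ} {y : Fin m → CSpace r s}, (∀ a, y a ∈ O) →
      ∀ᶠ v in 𝓝 y, ∀ a, v a ∈ O := fun {m y} hy => eventually_all.2 fun a =>
    (continuous_apply a).continuousAt.eventually_mem (hO.mem_nhds (hy a))
  -- One tuple is made generic while the other follows orthogonally and stays independent. Then the
  -- roles swap, and semicontinuity keeps the first one generic.
  obtain ⟨x, ⟨hxO, hx⟩, x', ⟨hx'O, hx'li⟩, hxx'⟩ :=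
    ((frequently_genericRank_le hO hconv hF fun a => (hx₀ a).1).and_eventually
      (eventually_exists_orthogonal hx₀li hort₀
        ((hopen fun a => (hx₀' a).1).and hx₀li'.eventually))).exists
  obtain ⟨y', ⟨hy'O, hy'⟩, y, ⟨hyO, hy⟩, hyy'⟩ :=
    ((frequently_genericRank_le hO hconv hF hx'O).and_eventually
      (eventually_exists_orthogonal hx'li (fun i j => hermForm_eq_zero_comm.1 (hxx' j i))
        ((hopen hxO).and (eventually_le_tupleRank hO hF.continuousOn hx)))).exists
  refine (add_le_add hy hy').trans (finrank_add_le_of_le_hermPerp (span_le_hermPerp_span ?_))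
  rintro _ ⟨p, ⟨hpO, hp⟩, rfl⟩ _ ⟨q, ⟨hqO, hq⟩, rfl⟩
  refine hort p hpO q hqO (mem_hermPerp.1 (span_le_hermPerp_span ?_ hp) q hq)
  rintro _ ⟨i, rfl⟩ _ ⟨j, rfl⟩
  exact hyy' i j

end Hermitian

/-! ### Lifts and the identity theorem on projective space -/

section LocalMap

variable {r s r' s' : ℕ}

theorem PSpace.isOpen_cone {U : Set (PSpace r s)} (hU : IsOpen U) :
    IsOpen {v : CSpace r s | ∃ hv : v ≠ 0, Projectivization.mk ℂ v hv ∈ U} := by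
  have h1 := isOpen_coinduced.1 hU
  have h2 : IsOpen {v : CSpace r s | v ≠ 0} := isOpen_ne
  have h3 := h2.isOpenMap_subtype_val _ h1
  convert h3 using 1
  ext v
  constructor
  · rintro ⟨hv, hvU⟩
    exact ⟨⟨v, hv⟩, hvU, rfl⟩
  · rintro ⟨⟨v, hv⟩, hvU, rfl⟩
    exact ⟨hv, hvU⟩

theorem PSpace.isOpen_image_mk {B : Set (CSpace r s)} (hB : IsOpen B) :
    IsOpen {p : PSpace r s | ∃ w, ∃ hw : w ≠ 0, w ∈ B ∧ Projectivization.mk ℂ w hw = p} := by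
  refine isOpen_coinduced.2 ?_
  have : (Projectivization.mk' ℂ : {v : CSpace r s // v ≠ 0} → PSpace r s) ⁻¹'
      {p : PSpace r s | ∃ w, ∃ hw : w ≠ 0, w ∈ B ∧ Projectivization.mk ℂ w hw = p} =
      ⋃ a : ℂˣ, {v : {v : CSpace r s // v ≠ 0} | (a : ℂ) • (v : CSpace r s) ∈ B} := by
    ext ⟨v, hv⟩
    simp only [Set.mem_preimage, Set.mem_ofPred_eq, Set.mem_iUnion, Projectivization.mk'_eq_mk]
    constructor
    · rintro ⟨w, hw, hwB, hwv⟩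
      obtain ⟨a, rfl⟩ := (Projectivization.mk_eq_mk_iff ℂ _ _ hw hv).1 hwv
      exact ⟨a, hwB⟩
    · rintro ⟨a, ha⟩
      have hav : (a : ℂ) • v ≠ 0 := smul_ne_zero a.ne_zero hv
      exact ⟨_, hav, ha, (Projectivization.mk_eq_mk_iff ℂ _ _ hav hv).2 ⟨a, rfl⟩⟩
  rw [this]
  refine isOpen_iUnion fun a => hB.preimage ?_
  fun_prop

/-- A holomorphic map between projective spaces has a holomorphic lift on a ball. -/
theorem PSpace.HolomorphicOn.exists_lift {U : Set (PSpace r s)} {f : PSpace r s → PSpace r' s'}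
    (hf : PSpace.HolomorphicOn f U) (hU : IsOpen U) {v : CSpace r s} (hv : v ≠ 0)
    (hvU : Projectivization.mk ℂ v hv ∈ U) :
    ∃ (B : Set (CSpace r s)) (F : CSpace r s → CSpace r' s'), IsOpen B ∧ Convex ℝ B ∧ v ∈ B ∧
      DifferentiableOn ℂ F B ∧ ∀ w ∈ B, ∃ (hw : w ≠ 0) (hF : F w ≠ 0),
        Projectivization.mk ℂ w hw ∈ U ∧
        f (Projectivization.mk ℂ w hw) = Projectivization.mk ℂ (F w) hF := by
  obtain ⟨O, F, hO, hvO, hF, hfF⟩ := hf v hv hvU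
  obtain ⟨ε, hε, hsub⟩ := Metric.isOpen_iff.1 (hO.inter (PSpace.isOpen_cone hU)) v
    ⟨hvO, hv, hvU⟩
  refine ⟨Metric.ball v ε, F, Metric.isOpen_ball, convex_ball v ε, Metric.mem_ball_self hε,
    hF.mono fun w hw => (hsub hw).1, fun w hw => ?_⟩
  obtain ⟨hwO, hw0, hwU⟩ := hsub hw
  obtain ⟨hFw, h⟩ := hfF w hw0 hwO hwU
  exact ⟨hw0, hFw, hwU, h⟩

theorem PSpace.submodule_mk_le_iff {v : CSpace r s} (hv : v ≠ 0)
    {W : Submodule ℂ (CSpace r s)} : (Projectivization.mk ℂ v hv).submodule ≤ W ↔ v ∈ W := by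
  rw [Projectivization.submodule_mk, Submodule.span_singleton_le_iff_mem]

/-- A holomorphic map on a connected open set which maps some nonempty open set into a linear
subspace maps the whole set into that subspace. -/
theorem PSpace.HolomorphicOn.submodule_le_of_isOpen {U : Set (PSpace r s)}
    {f : PSpace r s → PSpace r' s'} (hf : PSpace.HolomorphicOn f U) (hU : IsOpen U)
    (hconn : IsPreconnected U) (W : Submodule ℂ (CSpace r' s')) {V : Set (PSpace r s)}
    (hV : IsOpen V) (hVU : (U ∩ V).Nonempty) (hVW : ∀ p ∈ V, p ∈ U → (f p).submodule ≤ W) :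
    ∀ p ∈ U, (f p).submodule ≤ W := by
  -- `Q` is open by construction; it remains to show that it is closed relative to `U`.
  set Q := interior {p | p ∈ U → (f p).submodule ≤ W} with hQ
  have hVQ : V ⊆ Q := interior_maximal hVW hV
  have hUQ : U ⊆ Q := by
    refine hconn.subset_of_closure_inter_subset isOpen_interior
      (hVU.mono (Set.inter_subset_inter_right _ hVQ)) ?_
    rintro p ⟨hpQ, hpU⟩
    induction p using Projectivization.ind with
    | h v hv =>
    obtain ⟨B, F, hB, hBc, hvB, hF, hfF⟩ := hf.exists_lift hU hv hpU
    have hBo := PSpace.isOpen_image_mk hB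
    obtain ⟨_, ⟨w, hw, hwB, rfl⟩, hwQ⟩ := mem_closure_iff.1 hpQ _ hBo ⟨v, hv, hvB, rfl⟩
    have hFW : ∀ u ∈ B, F u ∈ W := by
      intro u hu
      by_contra hFu
      -- Independence of a single vector modulo `W` means lying outside `W`; it would spread from
      -- `u` to points arbitrarily near `w`, contradicting `w` representing a point of `Q`.
      have hfreq := frequently_linearIndependent_mkQ hB hBc hF W (fun _ : Fin 1 => w)
        (fun _ => u - w) (fun _ => hwB) (fun _ => by simpa using hu)
        (by
          rw [linearIndependent_unique_iff]
          simpa using hFu)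
      have hcont : Continuous fun t : ℂ => w + t • (u - w) := by fun_prop
      have hev1 : ∀ᶠ t in 𝓝 (0 : ℂ), w + t • (u - w) ∈ B :=
        hcont.continuousAt.eventually_mem (hB.mem_nhds (by simpa using hwB))
      have hev2 : ∀ᶠ t in 𝓝 (0 : ℂ), w + t • (u - w) ∈
          {v : CSpace r s | ∃ hv : v ≠ 0, Projectivization.mk ℂ v hv ∈ Q} :=
        hcont.continuousAt.eventually_mem ((PSpace.isOpen_cone isOpen_interior).mem_nhds
          (by simpa using ⟨hw, hwQ⟩))
      obtain ⟨t, ht, htB, ht0, htQ⟩ := (hfreq.and_eventually (hev1.and hev2)).exists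
      rw [linearIndependent_unique_iff] at ht
      obtain ⟨_, hF0, htU, hft⟩ := hfF _ htB
      have := interior_subset htQ htU
      rw [hft, PSpace.submodule_mk_le_iff] at this
      exact ht (by simpa using this)
    refine interior_maximal ?_ hBo ⟨v, hv, hvB, rfl⟩
    rintro _ ⟨u, hu, huB, rfl⟩ -
    obtain ⟨_, hF0, -, hfu⟩ := hfF u huB
    rw [hfu, PSpace.submodule_mk_le_iff]
    exact hFW u huB
  exact fun p hp => interior_subset (hUQ hp) hp

end LocalMap

theorem theorem3 (r s r' s' n n' : ℕ) (hn : r + s = n + 1) (hn' : r' + s' = n' + 1)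
    (U : Set (PSpace r s)) (f : PSpace r s → PSpace r' s') (hf : IsLocalOrthogonalMap U f)
    (h : ∃ a : ℕ, (a + 1) * (n + 1) ≤ n' ∧
      (n' : ℤ) ≤ ((a : ℤ) + 2) * (n : ℤ) - ((a : ℤ) ^ 2 + 2 * (a : ℤ) + 2)) :
    PSpace.LiesInHyperplane (f '' U) := by
  obtain ⟨a, ha1, ha2⟩ := h
  obtain ⟨p, hpU, hp⟩ := hf.exists_null
  have hpmk := p.mk_rep
  obtain ⟨B, F, hB, hBc, hpB, hF, hfF⟩ :=
    hf.holomorphic.exists_lift hf.isOpen p.rep_nonzero (by rwa [hpmk])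
  by_cases htop : Submodule.span ℂ (F '' B) = ⊤
  · exfalso
    have hort : ∀ z ∈ B, ∀ w ∈ B, hermForm z w = 0 → hermForm (F z) (F w) = 0 := by
      intro z hz w hw hzw
      obtain ⟨hz0, hFz, hzU, hfz⟩ := hfF z hz
      obtain ⟨hw0, hFw, hwU, hfw⟩ := hfF w hw
      have := hf.orthogonal _ hzU _ hwU ((PSpace.orth_mk_iff z w hz0 hw0).2 hzw)
      rwa [hfz, hfw, PSpace.orth_mk_iff] at this
    obtain ⟨k, hk⟩ : ∃ k, 2 * k = a * a + 3 * a + 4 := by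
      obtain ⟨m, hm⟩ := Nat.even_mul_succ_self a
      exact ⟨m + a + 2, by nlinarith⟩
    have hN2 : n' + 1 + (a * a + 2 * a + 1) ≤ (a + 2) * n := by
      zify
      nlinarith
    -- The two bounds on `n'` together force `n ≥ a² + 3a + 3`. This makes `n + 1 - k` positive.
    have hkn : k ≤ n := by nlinarith
    have hrank : n' + 1 ≤ genericRank F B (n + 1) := by
      have := finrank_span_image_le_genericRank F hB ⟨_, hpB⟩
      rw [htop, finrank_top] at this
      simpa [hn, hn'] using this
    have hlt := lt_add_of_growth (w := genericRank F B) (k' := n + 1 - k)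
      (genericRank_add_min_le hB hBc ⟨_, hpB⟩ hF) hk (by omega) hrank (by omega) hN2
    have hle := genericRank_add_genericRank_le hB hBc hpB p.rep_nonzero hp hF hort
      (k := k) (k' := n + 1 - k) (by omega) (by omega) (by omega)
    omega
  · obtain ⟨φ, hφ, hker⟩ := Submodule.exists_le_ker_of_lt_top _ (lt_top_iff_ne_top.2 htop)
    refine ⟨LinearMap.ker φ, Module.Dual.finrank_ker_add_one_of_ne_zero hφ, ?_⟩
    rintro _ ⟨q, hq, rfl⟩
    refine hf.holomorphic.submodule_le_of_isOpen hf.isOpen hf.isConnected.isPreconnected _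
      (PSpace.isOpen_image_mk hB) ⟨p, hpU, p.rep, p.rep_nonzero, hpB, hpmk⟩ ?_ q hq
    rintro _ ⟨u, hu, huB, rfl⟩ -
    obtain ⟨_, hF0, -, hfu⟩ := hfF u huB
    rw [hfu, PSpace.submodule_mk_le_iff]
    exact hker (Submodule.subset_span ⟨u, huB, rfl⟩)
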